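/- Let $\gamma=\mathcal N(0,1)$ and let $\sigma:\mathbb R\to\mathbb R$ be locally absolutely continuous with $\int(\sigma')^2\,d\gamma<\infty$, normalized by $\int\sigma\,d\gamma=0$ and $\int\sigma^2\,d\gamma=1$. Assume that its coefficient of nonlinearity $\mu:=1-\big(\int z\,\sigma(z)\,d\gamma(z)\big)^2$ is positive. For $\varphi:\mathbb R\to\mathbb R$ and $\rho\in[-1,1]$ put $\hat\varphi(\rho):=\mathbb E[\varphi(U)\varphi(V)]$, where $(U,V)$ is a centred Gaussian pair with unit variances and covariance $\rho$. Let $\hat\sigma^{(m)}$ be the $m$-fold iterate of $\hat\sigma$ (with $\hat\sigma^{(0)}=\mathrm{id}$). For depth $L$ and a fixed $c\in\{0,1\}$, the neural tangent kernel (NTK) matrix of unit vectors $x_1,\dots,x_n\in\mathbb R^d$ is $$K_{ij}=\sum_{h=1}^{L+1}\hat\sigma^{(h-1)}(\rho_{ij})\prod_{h'=h}^{L}\widehat{\sigma'}\big(\hat\sigma^{(h'-c)}(\rho_{ij})\big),\qquad \rho_{ij}=x_i\cdot x_j .$$ (Here $c=1$ is the infinite-width limit for the fully connected network with $L$ hidden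 layers, and $c=0$ is an index convention also found in the literature; the result is asserted for both.) For every $n\ge 2$ let there be given: unit vectors $x_1,\dots,x_n\in\mathbb R^{d_n}$; a number $\delta_n>0$ with $\delta_n\le 1-|x_i\cdot x_j|$ for all $i\ne j$; a depth $L_n\in\mathbb N$ with $L_n\ge L_{\mathrm{conv}}:=\dfrac{8\log(n/\delta_n)}{\mu}$; and a symmetric sparsification $\tilde K=\tilde K_n$ of the NTK matrix $K=K_n$ of depth $L_n$. The latter means that $\tilde K$ is symmetric, $\tilde K_{ii}=K_{ii}$ for all $i$, $\tilde K_{ij}\in\{K_{ij},0\}$ for all $i\ne j$, and each row of $\tilde K$ has at most $s_n$ nonzero off-diagonal entries, where $s_n=O(\log n)$. Let $\kappa(\tilde K)$ be the ratio of the largest to the smallest singular value of $\tilde K$. Then: 1. for every $n\ge2$, every eigenvalue $\lambda$ of $\tilde K_n$ satisfies $K_{11}\left(1-\frac1n\right)\le\lambda\le K_{11}\left(1+\frac1n\right)$; 2. for every $n\ge2$, $\;1\le\kappa(\tilde K_n)\le\dfrac{1+1/n}{1-1/n}$; 3. $\kappa(\tilde K_n)\to1$ as $n\to\infty$; in particular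 $\kappa(\tilde K_n)=O(\log n)$, the conditioning required by the quantum linear systems solver. -/

import Mathlib

open MeasureTheory ProbabilityTheory Filter Topology Asymptotics

noncomputable section

namespace SparseNTK

/-- The standard Gaussian law `N(0,1)` on the real line. -/
abbrev stdNormal : Measure ℝ := gaussianReal 0 1

/-- Normalised activation functions: `E[σ(X)] = 0` and `V[σ(X)] = E[σ(X)²] = 1` for
`X ∼ N(0,1)`.  So that the derivative `σ'` and the expectations of products of values of `σ'`
which enter the neural tangent kernel are meaningful, `σ` is locally absolutely continuous (it is
the integral of its almost everywhere derivative) and `E[σ'(X)²] < ∞`. -/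
structure IsNormalizedActivation (σ : ℝ → ℝ) : Prop where
  absCont : ∀ a b : ℝ, AbsolutelyContinuousOnInterval σ a b
  memLp_deriv : MemLp (deriv σ) 2 stdNormal
  mean_eq_zero : ∫ z, σ z ∂stdNormal = 0
  variance_eq_one : ∫ z, σ z ^ 2 ∂stdNormal = 1

/-- The coefficient of nonlinearity `μ = 1 - (E[X σ(X)])²`, `X ∼ N(0,1)`. -/
def nonlinearity (σ : ℝ → ℝ) : ℝ := 1 - (∫ z, z * σ z ∂stdNormal) ^ 2

/-- The dual activation `φ̂(ρ) = E[φ(U) φ(V)]`, where `(U, V)` is a centred Gaussian pair with unit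
variances and covariance `ρ ∈ [-1, 1]`, realised as `U = Z₁`, `V = ρ Z₁ + √(1 - ρ²) Z₂` with
independent standard Gaussians `Z₁, Z₂`.  For unit vectors `x, y` with `x ⬝ y = ρ` and
`w ∼ N(0, I)`, the pair `(w ⬝ x, w ⬝ y)` has exactly this law. -/
def dual (φ : ℝ → ℝ) (ρ : ℝ) : ℝ :=
  ∫ z : ℝ × ℝ, φ z.1 * φ (ρ * z.1 + √(1 - ρ ^ 2) * z.2) ∂(stdNormal.prod stdNormal)

/-- The neural tangent kernel of the fully connected network with `L` hidden layers and activation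
`σ`, as a function of the inner product `ρ` of two unit vectors:
`∑_{h=1}^{L+1} σ̂^{(h-1)}(ρ) ∏_{h'=h}^{L} (σ')^(σ̂^{(h'-c)}(ρ))`, where `σ̂^{(m)}` is the `m`-fold
iterate of the dual activation and `(σ')^` is the dual of the derivative of `σ`.
The index shift `c` accommodates both conventions in use: the printed formula has `c = 0`, while
`c = 1` is the infinite-width limit of the gradient kernel of the network. -/
def ntkFun (c : ℕ) (σ : ℝ → ℝ) (L : ℕ) (ρ : ℝ) : ℝ :=
  ∑ h ∈ Finset.Icc 1 (L + 1),
    (dual σ)^[h - 1] ρ * ∏ h' ∈ Finset.Icc h L, dual (deriv σ) ((dual σ)^[h' - c] ρ)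

/-- The NTK matrix of a data set `x₁, …, xₙ`: `K i j` is the NTK at `x i ⬝ x j`. -/
def ntkMatrix (c : ℕ) (σ : ℝ → ℝ) (L : ℕ) {n d : ℕ} (x : Fin n → EuclideanSpace ℝ (Fin d)) :
    Matrix (Fin n) (Fin n) ℝ :=
  Matrix.of fun i j => ntkFun c σ L (inner ℝ (x i) (x j))

/-- The separability `δᵢⱼ = 1 - |xᵢ ⬝ xⱼ|` of two data points. -/
def separability {n d : ℕ} (x : Fin n → EuclideanSpace ℝ (Fin d)) (i j : Fin n) : ℝ :=
  1 - |inner ℝ (x i) (x j)|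

/-- The depth `L_conv = 8 log(n / δ) / μ`. -/
def convDepth (n : ℕ) (δ μ : ℝ) : ℝ := 8 * Real.log (n / δ) / μ

/-- `M` is a (symmetric) sparsification of `K`: it keeps the whole diagonal, each of its
off-diagonal entries is either kept or replaced by zero, the pattern is symmetric, and every row
(hence every column) has at most `s` nonzero off-diagonal entries. -/
structure IsSparsification {n : ℕ} (K M : Matrix (Fin n) (Fin n) ℝ) (s : ℕ) : Prop where
  symm : M.IsSymm
  diag : ∀ i, M i i = K i i
  offDiag : ∀ i j, i ≠ j → M i j = K i j ∨ M i j = 0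
  row_le : ∀ i, {j | j ≠ i ∧ M i j ≠ 0}.ncard ≤ s

/-- The condition number of a square matrix: the ratio of its largest to its smallest singular
value (Mathlib lists the singular values in decreasing order, starting at index `0`). -/
def conditionNumber {n : ℕ} (A : Matrix (Fin n) (Fin n) ℝ) : ℝ :=
  (Matrix.toEuclideanLin A).singularValues 0 / (Matrix.toEuclideanLin A).singularValues (n - 1)

end SparseNTK

end

/-! Expanding in Hermite polynomials, the dual of `φ` is `∑ aₙ² ρⁿ` with `aₙ` the Hermite
coefficients of `φ` (`hasSum_dual`). For `σ` the normalisation says `a₀ = 0`, `a₁² = 1 - μ` and `∑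
aₙ² = 1`, so one application of the dual shrinks `|ρ|` by at least the factor `1 - μ(1 - |ρ|)`.
Integration by parts gives `σ'` the squared coefficients `(n + 1) aₙ₊₁²`; hence `D = dual (deriv σ)
1 ≥ 1`, and the dual of `σ'` at `ρ` is at most `D` times the same factor. Thus every summand of the
kernel at `ρ` is its diagonal value times at most one common product of `L` such factors, wherever
the summand switches from iterates to derivatives (`abs_ntkFun_le`). Logistic decay bounds this
product by `δ⁻¹ (1 - μ/2)^L`, which is at most `1/n²` at the given depth. Replacing entries by zero
preserves this bound, so Gershgorin's theorem puts all eigenvalues within `K₁₁/n` of `K₁₁`. They are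
positive, so the singular values of the symmetric matrix are among them. -/

namespace SparseNTK

/-! ### Decay of the neural tangent kernel -/

/-- A sequence in `[0, 1)` that contracts at rate `1 - μ (1 - q)` decays geometrically, as its odds
`q / (1 - q)` shrink by the factor `1 - μ / 2` in each step. -/
theorem le_of_logistic_decay {μ δ : ℝ} (hμ0 : 0 < μ) (hμ1 : μ ≤ 1) (hδ : 0 < δ) {q : ℕ → ℝ}
    (hq : ∀ m, 0 ≤ q m) (hq0 : q 0 ≤ 1 - δ)
    (hstep : ∀ m, q (m + 1) ≤ q m * (1 - μ * (1 - q m))) (m : ℕ) :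
    q m ≤ δ⁻¹ * (1 - μ / 2) ^ m := by
  -- The second conjunct is the odds bound with its denominator cleared; the first keeps `1 - q m`
  -- positive.
  have key : ∀ m, q m ≤ 1 - δ ∧ q m ≤ (1 - q m) * (δ⁻¹ * (1 - μ / 2) ^ m) := by
    intro m
    induction m with
    | zero =>
      refine ⟨hq0, ?_⟩
      have : 1 ≤ (1 - q 0) * δ⁻¹ := by
        rw [← div_eq_mul_inv, le_div_iff₀ hδ]; linarith
      simp only [pow_zero, mul_one]
      linarith
    | succ m ih =>
      obtain ⟨h1, h2⟩ := ih
      set C := δ⁻¹ * (1 - μ / 2) ^ m with hC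
      have hC0 : 0 ≤ C := by
        have : 0 ≤ 1 - μ / 2 := by linarith
        positivity
      have hQ := hq m
      have hstep' := hstep m
      have hle : q (m + 1) ≤ q m := by
        have : 0 ≤ q m * (μ * (1 - q m)) := mul_nonneg hQ (mul_nonneg hμ0.le (by linarith))
        linarith
      refine ⟨hle.trans h1, ?_⟩
      have hCs : δ⁻¹ * (1 - μ / 2) ^ (m + 1) = C * (1 - μ / 2) := by rw [hC]; ring
      rw [hCs]
      -- One step multiplies the odds by at most `(1 - μ(1 - q)) / (1 + μ q)`; `e1` bounds this by
      -- `1 - μ/2`, and `e2` controls the new denominator.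
      have e1 : 1 - μ * (1 - q m) ≤ (1 - μ / 2) * (1 + μ * q m) := by
        have : 0 ≤ μ * (1 - μ * q m) := by
          refine mul_nonneg hμ0.le ?_
          nlinarith
        nlinarith
      have e2 : (1 - q m) * (1 + μ * q m) ≤ 1 - q (m + 1) := by nlinarith
      calc q (m + 1) ≤ q m * (1 - μ * (1 - q m)) := hstep'
        _ ≤ q m * ((1 - μ / 2) * (1 + μ * q m)) := by gcongr
        _ ≤ ((1 - q m) * C) * ((1 - μ / 2) * (1 + μ * q m)) := by
            refine mul_le_mul_of_nonneg_right h2 (mul_nonneg (by linarith) ?_)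
            have := mul_nonneg hμ0.le hQ
            linarith
        _ = ((1 - q m) * (1 + μ * q m)) * (C * (1 - μ / 2)) := by ring
        _ ≤ (1 - q (m + 1)) * (C * (1 - μ / 2)) :=
            mul_le_mul_of_nonneg_right e2 (mul_nonneg hC0 (by linarith))
  have hC0 : 0 ≤ δ⁻¹ * (1 - μ / 2) ^ m := by
    have : 0 ≤ 1 - μ / 2 := by linarith
    positivity
  have := key m
  nlinarith [mul_nonneg (hq m) hC0]

/-- At depth `8 log (n / δ) / μ` the geometric decay has reached `1 / n ^ 2`. -/
theorem inv_mul_pow_le_of_convDepth_le {μ δ : ℝ} (hμ0 : 0 < μ) (hμ1 : μ ≤ 1) (hδ : 0 < δ)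
    (hδ1 : δ ≤ 1) {n L : ℕ} (hn : 2 ≤ n) (hL : convDepth n δ μ ≤ L) :
    δ⁻¹ * (1 - μ / 2) ^ L ≤ 1 / (n : ℝ) ^ 2 := by
  have hn' : (2 : ℝ) ≤ n := by exact_mod_cast hn
  have hn0 : (0 : ℝ) < n := by linarith
  have hlog : 4 * Real.log (n / δ) ≤ μ / 2 * L := by
    rw [convDepth, div_le_iff₀ hμ0] at hL
    linarith
  -- From `1 - μ/2 ≤ exp(-μ/2)`, the constant 8 yields a fourth power, more than enough to absorb
  -- `δ⁻¹` and leave `1/n²`.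
  have h1 : (1 - μ / 2) ^ L ≤ (δ / n) ^ 4 := by
    calc (1 - μ / 2) ^ L ≤ Real.exp (-(μ / 2)) ^ L :=
          pow_le_pow_left₀ (by linarith) (by linarith [Real.add_one_le_exp (-(μ / 2))]) _
      _ = Real.exp (-(μ / 2 * L)) := by rw [← Real.exp_nat_mul]; ring_nf
      _ ≤ Real.exp (4 * Real.log (δ / n)) := by
          rw [Real.exp_le_exp, ← inv_div (n : ℝ) δ, Real.log_inv]; linarith
      _ = (δ / n) ^ 4 := by
          rw [show (4 : ℝ) * Real.log (δ / n) = ((4 : ℕ) : ℝ) * Real.log (δ / n) by norm_num,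
            Real.exp_nat_mul, Real.exp_log (by positivity)]
  calc δ⁻¹ * (1 - μ / 2) ^ L ≤ δ⁻¹ * (δ / n) ^ 4 := by gcongr
    _ = δ ^ 3 / (n ^ 2 * n ^ 2) := by field_simp
    _ ≤ 1 / (n ^ 2 * 1) := by
        gcongr
        · exact pow_le_one₀ hδ.le hδ1
        · exact one_le_pow₀ (by linarith)
    _ = 1 / (n : ℝ) ^ 2 := by rw [mul_one]

section Decay

variable {σ : ℝ → ℝ} {μ D : ℝ}

theorem iterate_dual_one (h1 : dual σ 1 = 1) (m : ℕ) : (dual σ)^[m] 1 = 1 :=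
  Function.iterate_fixed h1 m

theorem ntkFun_one (h1 : dual σ 1 = 1) (c L : ℕ) :
    ntkFun c σ L 1 =
      ∑ h ∈ Finset.Icc 1 (L + 1), ∏ _h' ∈ Finset.Icc h L, dual (deriv σ) 1 := by
  simp only [ntkFun, iterate_dual_one h1, one_mul]

theorem ntkFun_one_pos (h1 : dual σ 1 = 1) (hD : 0 < dual (deriv σ) 1) (c L : ℕ) :
    0 < ntkFun c σ L 1 := by
  rw [ntkFun_one h1]
  exact Finset.sum_pos (fun h _ => Finset.prod_pos fun _ _ => hD) ⟨1, by simp⟩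

theorem abs_iterate_dual_succ_le (hμ0 : 0 < μ) (hμ1 : μ ≤ 1)
    (hσ : ∀ ρ, |ρ| ≤ 1 → |dual σ ρ| ≤ |ρ| * (1 - μ * (1 - |ρ|))) {ρ : ℝ} (hρ : |ρ| ≤ 1) (m : ℕ) :
    |(dual σ)^[m] ρ| ≤ 1 ∧
      |(dual σ)^[m + 1] ρ| ≤ |(dual σ)^[m] ρ| * (1 - μ * (1 - |(dual σ)^[m] ρ|)) := by
  have step : ∀ m, |(dual σ)^[m] ρ| ≤ 1 →
      |(dual σ)^[m + 1] ρ| ≤ |(dual σ)^[m] ρ| * (1 - μ * (1 - |(dual σ)^[m] ρ|)) := by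
    intro m hm
    rw [Function.iterate_succ_apply']
    exact hσ _ hm
  have bd : ∀ m, |(dual σ)^[m] ρ| ≤ 1 := by
    intro m
    induction m with
    | zero => simpa using hρ
    | succ m ih =>
      refine (step m ih).trans (mul_le_one₀ ih ?_ ?_) <;> nlinarith [abs_nonneg ((dual σ)^[m] ρ)]
  exact ⟨bd m, step m (bd m)⟩

/-- Off the diagonal the neural tangent kernel is smaller than on the diagonal by the factor
`δ⁻¹ (1 - μ / 2) ^ L`. -/
theorem abs_ntkFun_le (hμ0 : 0 < μ) (hμ1 : μ ≤ 1) (hD : 0 < dual (deriv σ) 1)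
    (h1 : dual σ 1 = 1)
    (hσ : ∀ ρ, |ρ| ≤ 1 → |dual σ ρ| ≤ |ρ| * (1 - μ * (1 - |ρ|)))
    (hσ' : ∀ ρ, |ρ| ≤ 1 → |dual (deriv σ) ρ| ≤ dual (deriv σ) 1 * (1 - μ * (1 - |ρ|)))
    {c : ℕ} (hc : c ≤ 1) (L : ℕ) {δ ρ : ℝ} (hδ : 0 < δ) (hρ : |ρ| ≤ 1 - δ) :
    |ntkFun c σ L ρ| ≤ ntkFun c σ L 1 * (δ⁻¹ * (1 - μ / 2) ^ L) := by
  have hρ1 : |ρ| ≤ 1 := by linarith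
  set r : ℕ → ℝ := fun m => |(dual σ)^[m] ρ| with hr
  set w : ℕ → ℝ := fun m => 1 - μ * (1 - r m) with hw
  -- `Q` majorises the iterates `r`. Since `w m ≤ 1 - μ(1 - Q m)`, it obeys the logistic recursion
  -- itself.
  set Q : ℕ → ℝ := fun m => r 0 * ∏ j ∈ Finset.range m, w j with hQ
  have hr0 : ∀ m, 0 ≤ r m := fun m => abs_nonneg _
  have hr1 : ∀ m, r m ≤ 1 := fun m => (abs_iterate_dual_succ_le hμ0 hμ1 hσ hρ1 m).1
  have hrs : ∀ m, r (m + 1) ≤ r m * w m := fun m =>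
    (abs_iterate_dual_succ_le hμ0 hμ1 hσ hρ1 m).2
  have hw0 : ∀ m, 0 ≤ w m := fun m => by
    have := hr0 m; simp only [hw]; nlinarith
  have hw1 : ∀ m, w m ≤ 1 := fun m => by
    have := hr1 m; simp only [hw]; nlinarith
  have hwmono : ∀ m, w (m + 1) ≤ w m := fun m => by
    have h : r (m + 1) ≤ r m := (hrs m).trans (mul_le_of_le_one_right (hr0 m) (hw1 m))
    simp only [hw]
    nlinarith
  have hQ0 : ∀ m, 0 ≤ Q m := fun m => mul_nonneg (hr0 0) (Finset.prod_nonneg fun j _ => hw0 j)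
  have hQs : ∀ m, Q (m + 1) = Q m * w m := fun m => by
    simp only [hQ, Finset.prod_range_succ, mul_assoc]
  have hrQ : ∀ m, r m ≤ Q m := by
    intro m
    induction m with
    | zero => simp [hQ]
    | succ m ih =>
      rw [hQs]
      exact (hrs m).trans (mul_le_mul_of_nonneg_right ih (hw0 m))
  have hQL : Q L ≤ δ⁻¹ * (1 - μ / 2) ^ L := by
    refine le_of_logistic_decay hμ0 hμ1 hδ hQ0 (by simpa [hQ, hr] using hρ) (fun m => ?_) L
    rw [hQs]
    refine mul_le_mul_of_nonneg_left ?_ (hQ0 m)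
    have := hrQ m
    simp only [hw]
    nlinarith
  refine le_trans ?_ (mul_le_mul_of_nonneg_left hQL (ntkFun_one_pos h1 hD c L).le)
  rw [ntkFun_one h1, Finset.sum_mul]
  refine (Finset.abs_sum_le_sum_abs _ _).trans (Finset.sum_le_sum fun h hh => ?_)
  obtain ⟨k, rfl⟩ : ∃ k, h = k + 1 := ⟨h - 1, by grind⟩
  have hk : k ≤ L := by grind
  rw [abs_mul, Finset.abs_prod, Nat.add_sub_cancel]
  have hfac : ∀ h' ∈ Finset.Icc (k + 1) L,
      |dual (deriv σ) ((dual σ)^[h' - c] ρ)| ≤ dual (deriv σ) 1 * w (h' - 1) := by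
    intro h' hh'
    have hpos : 1 ≤ h' := by grind
    refine (hσ' _ (hr1 _)).trans (mul_le_mul_of_nonneg_left ?_ hD.le)
    change w (h' - c) ≤ w (h' - 1)
    -- For `c = 0` the factor sits one iterate later, where `w` is no larger; for `c = 1` the
    -- indices agree.
    interval_cases c
    · have := hwmono (h' - 1)
      rwa [Nat.sub_add_cancel hpos] at this
    · exact le_rfl
  have hprod : ∏ h' ∈ Finset.Icc (k + 1) L, w (h' - 1) = ∏ j ∈ Finset.Ico k L, w j := by
    rw [← Finset.Ico_add_one_right_eq_Icc, ← Finset.prod_Ico_add' (fun j => w (j - 1)) k L 1]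
    simp
  -- The iterate supplies `w 0, …, w (k-1)` and the derivatives supply `w k, …, w (L-1)`: together
  -- `Q L`, independent of `k`.
  calc |(dual σ)^[k] ρ| * ∏ h' ∈ Finset.Icc (k + 1) L, |dual (deriv σ) ((dual σ)^[h' - c] ρ)|
      ≤ Q k * ∏ h' ∈ Finset.Icc (k + 1) L, (dual (deriv σ) 1 * w (h' - 1)) :=
        mul_le_mul (hrQ k) (Finset.prod_le_prod (fun _ _ => abs_nonneg _) hfac)
          (Finset.prod_nonneg fun _ _ => abs_nonneg _) (hQ0 k)
    _ = (∏ _h' ∈ Finset.Icc (k + 1) L, dual (deriv σ) 1) *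
          (r 0 * ((∏ j ∈ Finset.range k, w j) * ∏ j ∈ Finset.Ico k L, w j)) := by
        rw [Finset.prod_mul_distrib, hprod]; ring
    _ = _ := by rw [Finset.prod_range_mul_prod_Ico w hk]

end Decay

/-! ### Condition numbers of symmetric matrices -/

/-- For symmetric `T`, `T² v = s² v` factors as `(T - s)(T + s) v = 0`. Either `(T + s) v` is an
eigenvector for `s`, or `-s ≤ 0` is an eigenvalue, which positivity excludes. -/
theorem hasEigenvalue_toLin'_singularValue {n : ℕ} {A : Matrix (Fin n) (Fin n) ℝ}
    (hA : A.IsSymm) (hpos : ∀ lam, Module.End.HasEigenvalue (Matrix.toLin' A) lam → 0 < lam)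
    {i : ℕ} (hi : i < n) :
    Module.End.HasEigenvalue (Matrix.toLin' A) ((Matrix.toEuclideanLin A).singularValues i) := by
  set T := Matrix.toEuclideanLin A with hT
  set s := T.singularValues i with hs
  have hs0 : 0 ≤ s := T.singularValues_nonneg i
  have transfer : ∀ {lam : ℝ} {v : EuclideanSpace ℝ (Fin n)}, v ≠ 0 → T v = lam • v →
      Module.End.HasEigenvalue (Matrix.toLin' A) lam := by
    intro lam v hv h
    refine Module.End.hasEigenvalue_of_hasEigenvector (x := WithLp.ofLp v) ⟨?_, ?_⟩
    · rw [Module.End.mem_eigenspace_iff]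
      simpa [hT] using congrArg WithLp.ofLp h
    · simpa using hv
  have hadj : T.adjoint = T := by
    rw [hT, ← Matrix.toEuclideanLin_conjTranspose_eq_adjoint,
      Matrix.conjTranspose_eq_transpose_of_trivial, hA]
  obtain ⟨v, hv⟩ := (T.hasEigenvalue_adjoint_comp_self_sq_singularValues
    (n := i) (by simpa using hi)).exists_hasEigenvector
  have hvT : T (T v) = (s * s) • v := by
    have := hv.apply_eq_smul
    rwa [hadj, LinearMap.comp_apply, sq] at this
  by_cases hw : T v + s • v = 0
  · have h1 : T v = (-s) • v := by rw [neg_smul]; exact eq_neg_of_add_eq_zero_left hw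
    have := hpos _ (transfer hv.2 h1)
    linarith
  · refine transfer hw ?_
    rw [map_add, map_smul, hvT, smul_add, smul_smul, add_comm]

theorem one_le_conditionNumber_and_le {n : ℕ} (hn : 0 < n) {A : Matrix (Fin n) (Fin n) ℝ}
    (hA : A.IsSymm) {a b : ℝ} (ha : 0 < a)
    (hab : ∀ lam, Module.End.HasEigenvalue (Matrix.toLin' A) lam → a ≤ lam ∧ lam ≤ b) :
    1 ≤ conditionNumber A ∧ conditionNumber A ≤ b / a := by
  have hpos : ∀ lam, Module.End.HasEigenvalue (Matrix.toLin' A) lam → 0 < lam :=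
    fun lam h => ha.trans_le (hab lam h).1
  have h0 := hab _ (hasEigenvalue_toLin'_singularValue hA hpos hn)
  have h1 := hab _ (hasEigenvalue_toLin'_singularValue hA hpos (Nat.sub_lt hn one_pos))
  rw [conditionNumber]
  constructor
  · rw [one_le_div (ha.trans_le h1.1)]
    exact (Matrix.toEuclideanLin A).singularValues_antitone (Nat.zero_le _)
  · exact div_le_div₀ (ha.le.trans (h0.1.trans h0.2)) h0.2 ha h1.1

/-- Gershgorin's theorem: each disc is centred at `a`, and its radius sums `n - 1` off-diagonal
entries. -/
theorem abs_eigenvalue_sub_le {n : ℕ} {A : Matrix (Fin n) (Fin n) ℝ} {a ε : ℝ}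
    (hdiag : ∀ i, A i i = a) (hoff : ∀ i j, i ≠ j → |A i j| ≤ ε) {lam : ℝ}
    (hlam : Module.End.HasEigenvalue (Matrix.toLin' A) lam) :
    |lam - a| ≤ (n - 1) * ε := by
  obtain ⟨k, hk⟩ := eigenvalue_mem_ball hlam
  rw [Metric.mem_closedBall, Real.dist_eq, hdiag] at hk
  refine hk.trans ((Finset.sum_le_card_nsmul _ _ ε fun j hj => ?_).trans_eq ?_)
  · exact hoff k j (Finset.ne_of_mem_erase hj).symm
  · have : 1 ≤ n := k.pos
    simp [Finset.card_erase_of_mem, Nat.cast_sub this]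

open Polynomial

/-! ### Gaussian integration by parts -/

theorem memLp_eval (p : ℝ[X]) : MemLp (fun x => p.eval x) 2 stdNormal := by
  induction p using Polynomial.induction_on' with
  | add p q hp hq => simpa only [eval_add] using! hp.add hq
  | monomial n a =>
    simp only [eval_monomial]
    refine MemLp.const_mul ?_ a
    rw [memLp_two_iff_integrable_sq (by fun_prop)]
    simp_rw [← pow_mul]
    exact integrable_pow_of_mem_interior_integrableExpSet (X := id) (by simp) (n * 2)

theorem contDiff_eval (p : ℝ[X]) : ContDiff ℝ 1 (fun x => p.eval x) := by
  simpa only [coe_aeval_eq_eval] using! p.contDiff_aeval (𝕜 := ℝ) 1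

theorem integrable_mul_eval {f : ℝ → ℝ} (hf : MemLp f 2 stdNormal) (p : ℝ[X]) :
    Integrable (fun x => f x * p.eval x) stdNormal :=
  hf.integrable_mul (memLp_eval p)

theorem integrable_stdNormal_iff {f : ℝ → ℝ} :
    Integrable f stdNormal ↔ Integrable (fun x => gaussianPDFReal 0 1 x * f x) := by
  rw [stdNormal, gaussianReal_of_var_ne_zero _ one_ne_zero,
    integrable_withDensity_iff_integrable_smul' (measurable_gaussianPDF _ _)
      (ae_of_all _ fun _ => gaussianPDF_lt_top)]
  simp

theorem hasDerivAt_gaussianPDFReal (x : ℝ) :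
    HasDerivAt (gaussianPDFReal 0 1) (-x * gaussianPDFReal 0 1 x) x := by
  have h : HasDerivAt (fun y : ℝ => (√(2 * Real.pi * (1 : NNReal)))⁻¹ *
      Real.exp (-(y - 0) ^ 2 / (2 * (1 : NNReal)))) _ x :=
    ((((((hasDerivAt_id x).sub_const 0).pow 2).neg.div_const _).exp).const_mul _)
  rw [gaussianPDFReal_def]
  convert! h using 1
  simp
  ring

/-- An integrable function on the line that is locally the integral of its integrable derivative
has a derivative of integral zero. -/
theorem integral_eq_zero_of_intervalIntegral_eq_sub {F G : ℝ → ℝ} (hF : Integrable F)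
    (hG : Integrable G) (h : ∀ a b, ∫ x in a..b, G x = F b - F a) : ∫ x, G x = 0 := by
  have hlim : Tendsto (fun b : ℝ => F b - F (-b)) atTop (𝓝 (∫ x, G x)) := by
    simp_rw [← h]
    exact intervalIntegral_tendsto_integral hG tendsto_neg_atTop_atBot tendsto_id
  have hint : Integrable (fun b => F b - F (-b)) := hF.sub hF.comp_neg
  -- No decay of `F` is assumed: a function integrable near infinity that converges there has limit
  -- zero, because neighbourhoods of infinity have infinite measure.
  refine IntegrableAtFilter.eq_zero_of_tendsto (hint.integrableAtFilter atTop) (fun s hs => ?_) hlim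
  obtain ⟨a, ha⟩ := mem_atTop_sets.1 hs
  exact measure_mono_top (show Set.Ici a ⊆ s from ha) (by simp)

/-- **Gaussian integration by parts** against a polynomial. -/
theorem integral_deriv_mul_eval {f : ℝ → ℝ} (hac : ∀ a b, AbsolutelyContinuousOnInterval f a b)
    (hf : MemLp f 2 stdNormal) (hf' : MemLp (deriv f) 2 stdNormal) (p : ℝ[X]) :
    ∫ x, deriv f x * p.eval x ∂stdNormal =
      ∫ x, f x * (X * p - derivative p).eval x ∂stdNormal := by
  set φ := gaussianPDFReal 0 1 with hφ
  set q : ℝ → ℝ := fun x => p.eval x * φ x with hq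
  have hqd : ∀ x, HasDerivAt q ((derivative p - X * p).eval x * φ x) x := by
    intro x
    convert! (p.hasDerivAt x).mul (hasDerivAt_gaussianPDFReal x) using 1
    simp only [eval_sub, eval_mul, eval_X, hφ]
    ring
  have hqac : ∀ a b, AbsolutelyContinuousOnInterval q a b := by
    intro a b
    refine ContDiffOn.absolutelyContinuousOnInterval (ContDiff.contDiffOn ?_)
    have : ContDiff ℝ 1 φ := by rw [hφ, gaussianPDFReal_def]; fun_prop
    exact (contDiff_eval p).mul this
  have hF : Integrable (fun x => f x * q x) := by
    refine (integrable_stdNormal_iff.1 (integrable_mul_eval hf p)).congr (ae_of_all _ fun x => ?_)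
    simp only [hq, hφ]; ring
  -- Multiplied by the density `φ`, this difference is the a.e. derivative of `f * q`.
  have hG := (integrable_mul_eval hf' p).sub (integrable_mul_eval hf (X * p - derivative p))
  have hzero := integral_eq_zero_of_intervalIntegral_eq_sub hF (integrable_stdNormal_iff.1 hG)
    fun a b => by
      rw [← (hac a b).integral_deriv_mul_eq_sub (hqac a b)]
      refine intervalIntegral.integral_congr fun x _ => ?_
      simp only [(hqd x).deriv]
      simp only [hq, Pi.sub_apply, eval_sub, hφ]
      ring
  rw [← sub_eq_zero, ← integral_sub (integrable_mul_eval hf' p) (integrable_mul_eval hf _),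
    integral_gaussianReal_eq_integral_smul one_ne_zero]
  simpa using hzero

theorem integral_derivative_mul_eval (p q : ℝ[X]) :
    ∫ x, (derivative p).eval x * q.eval x ∂stdNormal =
      ∫ x, p.eval x * (X * q - derivative q).eval x ∂stdNormal := by
  have hd : deriv (fun x => p.eval x) = fun x => (derivative p).eval x := funext fun _ => p.deriv
  have h := integral_deriv_mul_eval (f := fun x => p.eval x)
    (fun a b => ContDiffOn.absolutelyContinuousOnInterval (contDiff_eval p).contDiffOn) (memLp_eval p)
    (hd ▸ memLp_eval (derivative p)) q
  rwa [hd] at h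

/-! ### Hermite polynomials -/

/-- The probabilists' Hermite polynomial with real coefficients. -/
noncomputable def realHermite (n : ℕ) : ℝ[X] := (hermite n).map (Int.castRingHom ℝ)

@[simp]
theorem realHermite_zero : realHermite 0 = 1 := by simp [realHermite]

@[simp]
theorem realHermite_one : realHermite 1 = X := by simp [realHermite]

theorem realHermite_succ (n : ℕ) :
    realHermite (n + 1) = X * realHermite n - derivative (realHermite n) := by
  simp [realHermite, hermite_succ, derivative_map]

theorem derivative_realHermite_succ (n : ℕ) :
    derivative (realHermite (n + 1)) = (n + 1 : ℝ[X]) * realHermite n := by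
  induction n with
  | zero => simp
  | succ n ih =>
    rw [realHermite_succ (n + 1), derivative_sub, derivative_mul, ih, derivative_X, derivative_mul,
      realHermite_succ n]
    simp
    ring

theorem X_mul_realHermite_succ (n : ℕ) :
    X * realHermite (n + 1) = realHermite (n + 2) + (n + 1 : ℝ[X]) * realHermite n := by
  rw [realHermite_succ (n + 1), derivative_realHermite_succ]
  ring

/-- The raising operator `p ↦ X p - p'` is adjoint to differentiation, which lowers the degree with
factor `n + 1`. -/
theorem integral_realHermite_mul (m n : ℕ) :
    ∫ x, (realHermite m).eval x * (realHermite n).eval x ∂stdNormal =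
      if m = n then (n.factorial : ℝ) else 0 := by
  induction n generalizing m with
  | zero =>
    cases m with
    | zero => simp
    | succ m =>
      have h := integral_derivative_mul_eval 1 (realHermite m)
      rw [← realHermite_succ] at h
      simpa using h.symm
  | succ n ih =>
    rw [realHermite_succ n, ← integral_derivative_mul_eval]
    cases m with
    | zero => simp
    | succ m =>
      simp only [derivative_realHermite_succ, eval_mul, mul_assoc, integral_const_mul, ih,
        eval_add, eval_natCast, eval_one]
      simp only [Nat.add_right_cancel_iff, mul_ite, mul_zero]
      split_ifs with h
      · subst h; simp [Nat.factorial_succ]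
      · rfl

/-- **Mehler's identity**: the Hermite polynomials are eigenfunctions of the noise operator. -/
theorem integral_realHermite_comp {ρ : ℝ} (hρ : |ρ| ≤ 1) (n : ℕ) (x : ℝ) :
    ∫ z, (realHermite n).eval (ρ * x + √(1 - ρ ^ 2) * z) ∂stdNormal =
      ρ ^ n * (realHermite n).eval x := by
  set s := √(1 - ρ ^ 2) with hs
  have hs2 : s ^ 2 = 1 - ρ ^ 2 := Real.sq_sqrt (by nlinarith [abs_le.1 hρ, sq_abs ρ, abs_nonneg ρ])
  set ℓ : ℝ[X] := C (ρ * x) + C s * X with hℓ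
  have hev : ∀ p : ℝ[X], ∀ z, p.eval (ρ * x + s * z) = (p.comp ℓ).eval z := by
    intro p z; simp [hℓ]
  have hint : ∀ p : ℝ[X], Integrable (fun z => p.eval (ρ * x + s * z)) stdNormal := by
    intro p
    simp_rw [hev]
    simpa using integrable_mul_eval (memLp_eval 1) (p.comp ℓ)
  have hz : ∀ p : ℝ[X], ∫ z, z * p.eval (ρ * x + s * z) ∂stdNormal =
      s * ∫ z, (derivative p).eval (ρ * x + s * z) ∂stdNormal := by
    intro p
    have h := integral_derivative_mul_eval (p.comp ℓ) 1
    have hd : derivative (p.comp ℓ) = C s * (derivative p).comp ℓ := by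
      rw [derivative_comp]; simp [hℓ]
    rw [hd] at h
    simp only [eval_mul, eval_C, eval_one, mul_one, derivative_one, sub_zero, eval_X, ← hev,
      integral_const_mul] at h
    rw [h]
    simp_rw [mul_comm]
  -- The `z` part of the argument contributes `s²` times the integral of `p'` by `hz`, and `s² - 1 =
  -- -ρ²`. With `p` a Hermite polynomial this is the three-term recursion.
  have hrec : ∀ p : ℝ[X], ∫ z, (X * p - derivative p).eval (ρ * x + s * z) ∂stdNormal =
      ρ * x * ∫ z, p.eval (ρ * x + s * z) ∂stdNormal -
        ρ ^ 2 * ∫ z, (derivative p).eval (ρ * x + s * z) ∂stdNormal := by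
    intro p
    have hi : Integrable (fun z => s * (z * p.eval (ρ * x + s * z))) stdNormal := by
      simp_rw [hev]
      simpa using (integrable_mul_eval (memLp_eval X) (p.comp ℓ)).const_mul s
    have e : ∀ z, (X * p - derivative p).eval (ρ * x + s * z) =
        ρ * x * p.eval (ρ * x + s * z) + s * (z * p.eval (ρ * x + s * z)) -
          (derivative p).eval (ρ * x + s * z) := by
      intro z; simp only [eval_sub, eval_mul, eval_X]; ring
    have hadd : Integrable (fun z => ρ * x * p.eval (ρ * x + s * z) +
        s * (z * p.eval (ρ * x + s * z))) stdNormal := ((hint p).const_mul _).add hi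
    simp_rw [e]
    rw [integral_sub hadd (hint _),
      integral_add ((hint p).const_mul _) hi, integral_const_mul, integral_const_mul, hz]
    linear_combination (∫ z, (derivative p).eval (ρ * x + s * z) ∂stdNormal) * hs2
  induction n using Nat.twoStepInduction with
  | zero => simp
  | one =>
    have h := hrec 1
    simp only [mul_one, derivative_one, sub_zero, eval_one, eval_zero] at h
    simpa using h
  | more n ih0 ih1 =>
    rw [realHermite_succ (n + 1), hrec, ih1, derivative_realHermite_succ]
    simp only [eval_mul, eval_add, eval_natCast, eval_one, integral_const_mul, ih0, eval_sub, eval_X]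
    ring

/-! ### Completeness of the Hermite polynomials -/

theorem integral_mul_pow_eq_zero {g : ℝ → ℝ} (hg : MemLp g 2 stdNormal)
    (h : ∀ n, ∫ x, g x * (realHermite n).eval x ∂stdNormal = 0) (k : ℕ) :
    ∫ x, g x * x ^ k ∂stdNormal = 0 := by
  -- Generalised over `n`, since multiplying by `X` moves the Hermite index both up and down.
  have key : ∀ k n, ∫ x, g x * (X ^ k * realHermite n).eval x ∂stdNormal = 0 := by
    intro k
    induction k with
    | zero => intro n; simpa using h n
    | succ k ih =>
      intro n
      cases n with
      | zero => simpa [pow_succ] using ih 1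
      | succ n =>
        have e : X ^ (k + 1) * realHermite (n + 1) =
            X ^ k * realHermite (n + 2) + C (n + 1 : ℝ) * (X ^ k * realHermite n) := by
          rw [pow_succ, mul_assoc, X_mul_realHermite_succ]; simp; ring
        rw [e]
        simp only [eval_add, mul_add, eval_mul (p := C _), eval_C, mul_left_comm (g _)]
        rw [integral_add (integrable_mul_eval hg _) ((integrable_mul_eval hg _).const_mul _),
          integral_const_mul, ih, ih]
        simp
  simpa using key k 0

theorem memLp_exp_abs (t : ℝ) : MemLp (fun x => Real.exp |t * x|) 2 stdNormal := by
  rw [memLp_two_iff_integrable_sq (by fun_prop)]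
  refine Integrable.mono' ((integrable_exp_mul_gaussianReal (μ := 0) (v := 1) (2 * t)).add
    (integrable_exp_mul_gaussianReal (-(2 * t)))) (by fun_prop) (ae_of_all _ fun x => ?_)
  rw [Real.norm_of_nonneg (by positivity), ← Real.exp_nat_mul]
  rcases abs_cases (t * x) with ⟨h, -⟩ | ⟨h, -⟩ <;> rw [h]
  · have : (2 : ℕ) * (t * x) = 2 * t * x := by push_cast; ring
    simp only [Pi.add_apply, this, le_add_iff_nonneg_right]
    positivity
  · have : (2 : ℕ) * (-(t * x)) = -(2 * t) * x := by push_cast; ring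
    simp only [Pi.add_apply, this, le_add_iff_nonneg_left]
    positivity

/-- The exponential series may be integrated termwise, dominated by `|g| exp |t x|`, a product of
two `L²` functions. -/
theorem integral_mul_cexp_eq_zero {g : ℝ → ℝ} (hg : MemLp g 2 stdNormal)
    (h : ∀ k : ℕ, ∫ x, g x * x ^ k ∂stdNormal = 0) (t : ℝ) :
    ∫ x, (g x : ℂ) * Complex.exp (t * x * Complex.I) ∂stdNormal = 0 := by
  have hs : HasSum (fun k : ℕ => ∫ x, (g x : ℂ) * ((t * x * Complex.I) ^ k / k.factorial)
      ∂stdNormal) (∫ x, (g x : ℂ) * Complex.exp (t * x * Complex.I) ∂stdNormal) := by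
    refine hasSum_integral_of_dominated_convergence
      (fun k x => |g x| * (|t * x| ^ k / k.factorial)) (fun k => ?_)
      (fun k => ae_of_all _ fun x => ?_) (ae_of_all _ fun x => ?_) ?_ (ae_of_all _ fun x => ?_)
    · exact (Complex.continuous_ofReal.comp_aestronglyMeasurable hg.1).mul (by fun_prop)
    · simp [abs_mul]
    · exact (Real.summable_pow_div_factorial _).mul_left _
    · have e : ∀ x, ∑' k : ℕ, |g x| * (|t * x| ^ k / k.factorial) = |g x| * Real.exp |t * x| := by
        intro x
        rw [tsum_mul_left, Real.exp_eq_exp_ℝ, NormedSpace.exp_eq_tsum_div]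
      simp_rw [e]
      exact hg.abs.integrable_mul (memLp_exp_abs t)
    · refine HasSum.mul_left _ ?_
      rw [Complex.exp_eq_exp_ℂ]
      exact NormedSpace.expSeries_div_hasSum_exp _
  rw [← hs.tsum_eq]
  refine (tsum_congr fun k => ?_).trans tsum_zero
  have e : ∀ x : ℝ, (g x : ℂ) * ((t * x * Complex.I) ^ k / k.factorial) =
      ((t * Complex.I) ^ k / k.factorial) * ((g x * x ^ k : ℝ) : ℂ) := by
    intro x; push_cast; ring
  simp_rw [e]
  rw [integral_const_mul, integral_complex_ofReal, h]
  simp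

/-- The positive and negative parts of `g` are densities of finite measures with equal
characteristic functions, hence of equal measures. -/
theorem ae_eq_zero_of_integral_mul_cexp {g : ℝ → ℝ} (hg : Integrable g stdNormal)
    (h : ∀ t : ℝ, ∫ x, (g x : ℂ) * Complex.exp (t * x * Complex.I) ∂stdNormal = 0) :
    g =ᵐ[stdNormal] 0 := by
  have hm : AEMeasurable g stdNormal := hg.1.aemeasurable
  set u : ℝ → ENNReal := fun x => ENNReal.ofReal (g x) with hu
  set v : ℝ → ENNReal := fun x => ENNReal.ofReal (-g x) with hv
  have hum : AEMeasurable u stdNormal := hm.ennreal_ofReal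
  have hvm : AEMeasurable v stdNormal := hm.neg.ennreal_ofReal
  have hufin : ∫⁻ x, u x ∂stdNormal ≠ ⊤ := hg.lintegral_lt_top.ne
  have hvfin : ∫⁻ x, v x ∂stdNormal ≠ ⊤ := hg.neg.lintegral_lt_top.ne
  have := isFiniteMeasure_withDensity hufin
  have := isFiniteMeasure_withDensity hvfin
  have hbd : ∀ {a : ℝ → ℝ}, Integrable a stdNormal → ∀ t : ℝ,
      Integrable (fun x => (a x : ℂ) * Complex.exp (t * x * Complex.I)) stdNormal := by
    intro a ha t
    refine ha.ofReal.mul_bdd (c := 1) (by fun_prop) (ae_of_all _ fun x => ?_)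
    rw [← Complex.ofReal_mul, Complex.norm_exp_ofReal_mul_I]
  have heq : stdNormal.withDensity u = stdNormal.withDensity v := by
    refine Measure.ext_of_charFun (funext fun t => ?_)
    rw [charFun_apply_real, charFun_apply_real,
      integral_withDensity_eq_integral_toReal_smul₀ hum (ae_of_all _ fun _ => ENNReal.ofReal_lt_top),
      integral_withDensity_eq_integral_toReal_smul₀ hvm (ae_of_all _ fun _ => ENNReal.ofReal_lt_top)]
    have i1 := hbd hg.pos_part t
    have i2 := hbd hg.neg_part t
    have e1 : ∀ x, (u x).toReal • Complex.exp (t * x * Complex.I) =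
        ((max (g x) 0 : ℝ) : ℂ) * Complex.exp (t * x * Complex.I) := fun x => by
      simp only [hu, ENNReal.toReal_ofReal', Complex.real_smul]
    have e2 : ∀ x, (v x).toReal • Complex.exp (t * x * Complex.I) =
        ((max (-g x) 0 : ℝ) : ℂ) * Complex.exp (t * x * Complex.I) := fun x => by
      simp only [hv, ENNReal.toReal_ofReal', Complex.real_smul]
    simp_rw [e1, e2]
    rw [← sub_eq_zero, ← integral_sub i1 i2, ← h t]
    refine integral_congr_ae (ae_of_all _ fun x => ?_)
    simp only [← sub_mul, ← Complex.ofReal_sub]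
    congr 2
    rcases le_total (g x) 0 with h0 | h0 <;> simp [h0]
  filter_upwards [(withDensity_eq_iff hum hvm hufin).1 heq] with x hx
  simp only [hu, hv] at hx
  rcases le_total (g x) 0 with h0 | h0
  · rw [ENNReal.ofReal_of_nonpos h0, eq_comm, ENNReal.ofReal_eq_zero] at hx
    exact le_antisymm h0 (neg_nonpos.1 hx)
  · rw [ENNReal.ofReal_of_nonpos (p := -g x) (by linarith), ENNReal.ofReal_eq_zero] at hx
    exact le_antisymm hx h0

/-! ### The Hermite expansion of a dual activation -/

/-- The coefficient of `φ` at the `n`-th normalised Hermite polynomial. -/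
noncomputable def hermiteCoeff (φ : ℝ → ℝ) (n : ℕ) : ℝ :=
  (√n.factorial)⁻¹ * ∫ x, φ x * (realHermite n).eval x ∂stdNormal

/-- The normalised Hermite polynomials as elements of `L²` of the standard normal law. -/
noncomputable def hermiteLp (n : ℕ) : Lp ℝ 2 stdNormal :=
  (√n.factorial)⁻¹ • (memLp_eval (realHermite n)).toLp _

theorem inner_toLp_hermiteLp {φ : ℝ → ℝ} (hφ : MemLp φ 2 stdNormal) (n : ℕ) :
    inner ℝ (hφ.toLp φ) (hermiteLp n) = hermiteCoeff φ n := by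
  rw [hermiteLp, inner_smul_right, hermiteCoeff, L2.inner_def]
  congr 1
  refine integral_congr_ae ?_
  filter_upwards [hφ.coeFn_toLp, (memLp_eval (realHermite n)).coeFn_toLp] with x h1 h2
  simp [h1, h2, mul_comm]

theorem orthonormal_hermiteLp : Orthonormal ℝ hermiteLp := by
  rw [orthonormal_iff_ite]
  intro m n
  rw [hermiteLp, inner_smul_left, inner_toLp_hermiteLp, hermiteCoeff, integral_realHermite_mul]
  split_ifs with h
  · subst h
    have : √(m.factorial : ℝ) * √(m.factorial : ℝ) = m.factorial :=
      Real.mul_self_sqrt (Nat.cast_nonneg _)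
    have h0 : √(m.factorial : ℝ) ≠ 0 := by positivity
    simp only [conj_trivial]
    field_simp
    linarith
  · simp

theorem orthogonal_span_hermiteLp :
    (Submodule.span ℝ (Set.range hermiteLp))ᗮ = ⊥ := by
  rw [Submodule.eq_bot_iff]
  intro g hg
  have hgm : MemLp g 2 stdNormal := Lp.memLp g
  have hcoeff : ∀ n, ∫ x, g x * (realHermite n).eval x ∂stdNormal = 0 := by
    intro n
    have h1 := (Submodule.mem_orthogonal' _ _).1 hg (hermiteLp n)
      (Submodule.subset_span (Set.mem_range_self n))
    rw [← Lp.toLp_coeFn g hgm, inner_toLp_hermiteLp, hermiteCoeff] at h1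
    exact (mul_eq_zero.1 h1).resolve_left (by positivity)
  exact Lp.eq_zero_iff_ae_eq_zero.2 (ae_eq_zero_of_integral_mul_cexp (hgm.integrable one_le_two)
    (integral_mul_cexp_eq_zero hgm (integral_mul_pow_eq_zero hgm hcoeff)))

/-- The Hermite polynomials as a Hilbert basis of `L²` of the standard normal law. -/
noncomputable def hermiteBasis : HilbertBasis ℕ ℝ (Lp ℝ 2 stdNormal) :=
  HilbertBasis.mkOfOrthogonalEqBot orthonormal_hermiteLp orthogonal_span_hermiteLp

@[simp]
theorem hermiteBasis_apply (n : ℕ) : hermiteBasis n = hermiteLp n := by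
  rw [hermiteBasis, HilbertBasis.coe_mkOfOrthogonalEqBot]

/-- The second component of a standard Gaussian pair of correlation `ρ`. -/
noncomputable def correlate (ρ : ℝ) (z : ℝ × ℝ) : ℝ := ρ * z.1 + √(1 - ρ ^ 2) * z.2

/-- Characteristic functions: independence adds the exponents, and `ρ² + (1 - ρ²) = 1`. -/
theorem measurePreserving_correlate {ρ : ℝ} (hρ : |ρ| ≤ 1) :
    MeasurePreserving (correlate ρ) (stdNormal.prod stdNormal) stdNormal := by
  have hm : Measurable (correlate ρ) := by unfold correlate; fun_prop
  refine ⟨hm, ?_⟩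
  have hρ2 : 0 ≤ 1 - ρ ^ 2 := by nlinarith [abs_le.1 hρ, sq_abs ρ, abs_nonneg ρ]
  have := Measure.isProbabilityMeasure_map (μ := stdNormal.prod stdNormal) hm.aemeasurable
  refine Measure.ext_of_charFun (funext fun t => ?_)
  rw [charFun_apply_real, integral_map hm.aemeasurable (by fun_prop)]
  have e : ∀ z : ℝ × ℝ, Complex.exp (t * (correlate ρ z : ℝ) * Complex.I) =
      Complex.exp ((t * ρ : ℝ) * z.1 * Complex.I) *
        Complex.exp ((t * √(1 - ρ ^ 2) : ℝ) * z.2 * Complex.I) := by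
    intro z
    rw [← Complex.exp_add, correlate]
    congr 1
    push_cast
    ring
  simp_rw [e]
  rw [integral_prod_mul (fun x : ℝ => Complex.exp ((t * ρ : ℝ) * x * Complex.I))
    (fun y : ℝ => Complex.exp ((t * √(1 - ρ ^ 2) : ℝ) * y * Complex.I)), ← charFun_apply_real,
    ← charFun_apply_real, charFun_gaussianReal, charFun_gaussianReal, charFun_gaussianReal,
    ← Complex.exp_add]
  congr 1
  have h2 : ((√(1 - ρ ^ 2) : ℝ) : ℂ) ^ 2 = 1 - (ρ : ℂ) ^ 2 := by
    rw [← Complex.ofReal_pow, Real.sq_sqrt hρ2]; simp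
  push_cast
  linear_combination (-(t : ℂ) ^ 2 / 2) * h2

/-- Composition with the first component of a Gaussian pair, an isometry of `L²` spaces. -/
noncomputable def fstLp : Lp ℝ 2 stdNormal →L[ℝ] Lp ℝ 2 (stdNormal.prod stdNormal) :=
  (Lp.compMeasurePreservingₗᵢ ℝ Prod.fst measurePreserving_fst).toContinuousLinearMap

/-- Composition with the second component of a Gaussian pair of correlation `ρ`. -/
noncomputable def correlateLp {ρ : ℝ} (hρ : |ρ| ≤ 1) :
    Lp ℝ 2 stdNormal →L[ℝ] Lp ℝ 2 (stdNormal.prod stdNormal) :=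
  (Lp.compMeasurePreservingₗᵢ ℝ _ (measurePreserving_correlate hρ)).toContinuousLinearMap

theorem inner_fstLp_correlateLp {ρ : ℝ} (hρ : |ρ| ≤ 1) {φ ψ : ℝ → ℝ} (hφ : MemLp φ 2 stdNormal)
    (hψ : MemLp ψ 2 stdNormal) :
    inner ℝ (fstLp (hφ.toLp φ)) (correlateLp hρ (hψ.toLp ψ)) =
      ∫ z, φ z.1 * ψ (correlate ρ z) ∂(stdNormal.prod stdNormal) := by
  have h1 : fstLp (hφ.toLp φ) = (hφ.comp_measurePreserving measurePreserving_fst).toLp _ := rfl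
  have h2 : correlateLp hρ (hψ.toLp ψ) =
      (hψ.comp_measurePreserving (measurePreserving_correlate hρ)).toLp _ := rfl
  rw [h1, h2, L2.inner_def]
  refine integral_congr_ae ?_
  filter_upwards [(hφ.comp_measurePreserving measurePreserving_fst).coeFn_toLp,
    (hψ.comp_measurePreserving (measurePreserving_correlate hρ)).coeFn_toLp] with z h1 h2
  simp [h1, h2, mul_comm]

/-- Integrating out the second Gaussian variable first leaves Mehler's identity. -/
theorem inner_fstLp_correlateLp_hermiteLp {ρ : ℝ} (hρ : |ρ| ≤ 1) {φ : ℝ → ℝ}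
    (hφ : MemLp φ 2 stdNormal) (n : ℕ) :
    inner ℝ (fstLp (hφ.toLp φ)) (correlateLp hρ (hermiteLp n)) = ρ ^ n * hermiteCoeff φ n := by
  have hint : Integrable (fun z : ℝ × ℝ => φ z.1 * (realHermite n).eval (correlate ρ z))
      (stdNormal.prod stdNormal) :=
    (hφ.comp_measurePreserving measurePreserving_fst).integrable_mul
      ((memLp_eval (realHermite n)).comp_measurePreserving (measurePreserving_correlate hρ))
  rw [hermiteLp, map_smul, inner_smul_right, inner_fstLp_correlateLp hρ hφ, integral_prod _ hint]
  simp only [correlate, integral_const_mul, integral_realHermite_comp hρ]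
  simp only [mul_left_comm (φ _), integral_const_mul]
  rw [hermiteCoeff]
  ring

/-- The dual activation is the power series whose coefficients are the squares of the Hermite
coefficients. -/
theorem hasSum_dual {φ : ℝ → ℝ} (hφ : MemLp φ 2 stdNormal) {ρ : ℝ} (hρ : |ρ| ≤ 1) :
    HasSum (fun n => hermiteCoeff φ n ^ 2 * ρ ^ n) (dual φ ρ) := by
  -- Parseval's identity, with the adjoint moving the correlation operator off the basis vectors'
  -- partner `φ`.
  have h := hermiteBasis.hasSum_inner_mul_inner
    ((correlateLp hρ).adjoint (fstLp (hφ.toLp φ))) (hφ.toLp φ)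
  rw [ContinuousLinearMap.adjoint_inner_left, inner_fstLp_correlateLp hρ hφ hφ] at h
  have e : ∀ n, inner ℝ ((correlateLp hρ).adjoint (fstLp (hφ.toLp φ))) (hermiteBasis n) *
      inner ℝ (hermiteBasis n) (hφ.toLp φ) = hermiteCoeff φ n ^ 2 * ρ ^ n := by
    intro n
    rw [hermiteBasis_apply, ContinuousLinearMap.adjoint_inner_left,
      inner_fstLp_correlateLp_hermiteLp hρ hφ, real_inner_comm, inner_toLp_hermiteLp]
    ring
  simpa only [e] using! h

theorem dual_one (φ : ℝ → ℝ) : dual φ 1 = ∫ x, φ x ^ 2 ∂stdNormal := by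
  simp only [dual, one_pow, sub_self, Real.sqrt_zero, zero_mul, add_zero, one_mul, ← sq]
  rw [integral_fun_fst (fun x => φ x ^ 2)]
  simp

/-- Integration by parts raises the Hermite index; the factor `n + 1` is the ratio of the
normalisations `(n + 1)!` and `n!`. -/
theorem hermiteCoeff_deriv {f : ℝ → ℝ} (hac : ∀ a b, AbsolutelyContinuousOnInterval f a b)
    (hf : MemLp f 2 stdNormal) (hf' : MemLp (deriv f) 2 stdNormal) (n : ℕ) :
    hermiteCoeff (deriv f) n ^ 2 = (n + 1) * hermiteCoeff f (n + 1) ^ 2 := by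
  rw [hermiteCoeff, hermiteCoeff, integral_deriv_mul_eval hac hf hf', ← realHermite_succ,
    mul_pow, mul_pow, inv_pow, inv_pow, Real.sq_sqrt (Nat.cast_nonneg _),
    Real.sq_sqrt (Nat.cast_nonneg _), Nat.factorial_succ]
  push_cast
  field_simp

/-! ### Contraction of dual activations -/

/-- Every term beyond the constant one carries at least one factor `|ρ|`. -/
theorem abs_le_of_hasSum_pow {p : ℕ → ℝ} (hp : ∀ n, 0 ≤ p n) {S T ρ : ℝ} (hS : HasSum p S)
    (hρ : |ρ| ≤ 1) (hT : HasSum (fun n => p n * ρ ^ n) T) :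
    |T| ≤ p 0 + |ρ| * (S - p 0) := by
  have hS1 : HasSum (fun n => p (n + 1)) (S - p 0) := by
    simpa using (hasSum_nat_add_iff' 1).2 hS
  have hT1 : HasSum (fun n => p (n + 1) * ρ ^ (n + 1)) (T - p 0) := by
    simpa using (hasSum_nat_add_iff' 1).2 hT
  have h : |T - p 0| ≤ |ρ| * (S - p 0) := by
    have := tsum_of_norm_bounded (hS1.mul_left |ρ|) (f := fun n => p (n + 1) * ρ ^ (n + 1))
      fun n => by
        rw [Real.norm_eq_abs, abs_mul, abs_of_nonneg (hp _), abs_pow, pow_succ, mul_comm]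
        refine mul_le_mul_of_nonneg_right ?_ (hp _)
        exact mul_le_of_le_one_left (abs_nonneg _) (pow_le_one₀ (abs_nonneg _) hρ)
    rwa [hT1.tsum_eq] at this
  have := abs_add_le (T - p 0) (p 0)
  rw [sub_add_cancel, abs_of_nonneg (hp 0)] at this
  linarith

section Activation

variable {σ : ℝ → ℝ}

theorem IsNormalizedActivation.memLp (hσ : IsNormalizedActivation σ) : MemLp σ 2 stdNormal := by
  have hc : Continuous σ := by
    rw [continuous_iff_continuousAt]
    intro x
    refine (hσ.absCont (x - 1) (x + 1)).continuousOn.continuousAt ?_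
    rw [Set.uIcc_of_le (by linarith)]
    exact Icc_mem_nhds (by linarith) (by linarith)
  rw [memLp_two_iff_integrable_sq hc.aestronglyMeasurable]
  -- The integral of a non-integrable function is 0 by default, so variance 1 forces integrability.
  refine Integrable.of_integral_ne_zero ?_
  rw [hσ.variance_eq_one]
  exact one_ne_zero

theorem IsNormalizedActivation.dual_one (hσ : IsNormalizedActivation σ) : dual σ 1 = 1 := by
  rw [SparseNTK.dual_one, hσ.variance_eq_one]

theorem hermiteCoeff_one_sq (σ : ℝ → ℝ) : hermiteCoeff σ 1 ^ 2 = 1 - nonlinearity σ := by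
  simp [hermiteCoeff, nonlinearity, mul_comm]

theorem IsNormalizedActivation.hasSum_sq_hermiteCoeff (hσ : IsNormalizedActivation σ) :
    HasSum (fun n => hermiteCoeff σ (n + 1) ^ 2) 1 := by
  have h := hasSum_dual hσ.memLp (ρ := 1) (by simp)
  simp only [one_pow, mul_one, hσ.dual_one] at h
  have h0 : hermiteCoeff σ 0 = 0 := by simp [hermiteCoeff, hσ.mean_eq_zero]
  simpa [h0] using (hasSum_nat_add_iff' 1).2 h

/-- For `ρ ≠ 0`, the series of `dual σ ρ / ρ` has constant term `1 - μ` and coefficients summing to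
1, so it is at most `1 - μ + |ρ| μ` in absolute value. -/
theorem IsNormalizedActivation.abs_dual_le (hσ : IsNormalizedActivation σ) {ρ : ℝ}
    (hρ : |ρ| ≤ 1) : |dual σ ρ| ≤ |ρ| * (1 - nonlinearity σ * (1 - |ρ|)) := by
  have h := hasSum_dual hσ.memLp hρ
  have h0 : hermiteCoeff σ 0 = 0 := by simp [hermiteCoeff, hσ.mean_eq_zero]
  have h1 : HasSum (fun n => hermiteCoeff σ (n + 1) ^ 2 * ρ ^ (n + 1)) (dual σ ρ) := by
    simpa [h0] using (hasSum_nat_add_iff' 1).2 h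
  rcases eq_or_ne ρ 0 with rfl | hne
  · have : dual σ 0 = 0 := by simpa using h1.tsum_eq.symm
    simp [this]
  · have h2 : HasSum (fun n => hermiteCoeff σ (n + 1) ^ 2 * ρ ^ n) (dual σ ρ / ρ) := by
      have e : ∀ n, hermiteCoeff σ (n + 1) ^ 2 * ρ ^ (n + 1) / ρ =
          hermiteCoeff σ (n + 1) ^ 2 * ρ ^ n := fun n => by field_simp; ring
      simpa only [e] using h1.div_const ρ
    have h3 := abs_le_of_hasSum_pow (fun n => sq_nonneg _) hσ.hasSum_sq_hermiteCoeff hρ h2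
    rw [zero_add, hermiteCoeff_one_sq, abs_div, div_le_iff₀ (abs_pos.2 hne)] at h3
    linarith

/-- The Gaussian Poincaré inequality, read off coefficientwise from `(n + 1) aₙ₊₁² ≥ aₙ₊₁²`. -/
theorem IsNormalizedActivation.one_le_dual_deriv (hσ : IsNormalizedActivation σ) :
    1 ≤ dual (deriv σ) 1 := by
  have h := hasSum_dual hσ.memLp_deriv (ρ := 1) (by simp)
  refine hasSum_le (fun n => ?_) hσ.hasSum_sq_hermiteCoeff h
  rw [one_pow, mul_one, hermiteCoeff_deriv hσ.absCont hσ.memLp hσ.memLp_deriv]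
  exact le_mul_of_one_le_left (sq_nonneg _) (by simp)

theorem IsNormalizedActivation.abs_dual_deriv_le (hσ : IsNormalizedActivation σ) {ρ : ℝ}
    (hρ : |ρ| ≤ 1) :
    |dual (deriv σ) ρ| ≤ dual (deriv σ) 1 * (1 - nonlinearity σ * (1 - |ρ|)) := by
  have hS := hasSum_dual hσ.memLp_deriv (ρ := 1) (by simp)
  simp only [one_pow, mul_one] at hS
  have h := abs_le_of_hasSum_pow (fun n => sq_nonneg _) hS hρ (hasSum_dual hσ.memLp_deriv hρ)
  rw [hermiteCoeff_deriv hσ.absCont hσ.memLp hσ.memLp_deriv, zero_add, hermiteCoeff_one_sq] at h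
  have hD := hσ.one_le_dual_deriv
  have h1 : 0 ≤ 1 - nonlinearity σ := by rw [← hermiteCoeff_one_sq]; exact sq_nonneg _
  simp only [Nat.cast_zero, zero_add, one_mul] at h
  -- The gap between the claimed bound and `h` is exactly `(D - 1)(1 - μ)(1 - |ρ|)`.
  have h2 := mul_nonneg (mul_nonneg (sub_nonneg.2 hD) h1) (sub_nonneg.2 hρ)
  linarith

end Activation

theorem tendsto_one_add_div_one_sub :
    Tendsto (fun n : ℕ => (1 + 1 / (n : ℝ)) / (1 - 1 / (n : ℝ))) atTop (𝓝 1) := by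
  have h := tendsto_one_div_atTop_nhds_zero_nat (𝕜 := ℝ)
  simpa using! (h.const_add 1).div (h.const_sub 1) (by norm_num)

end SparseNTK

/-! ### Spectrum and conditioning of the sparsified kernel -/

theorem mainTheorem4
    (c : ℕ) (hc : c = 0 ∨ c = 1)
    (σ : ℝ → ℝ) (hσ : SparseNTK.IsNormalizedActivation σ) (hμ : 0 < SparseNTK.nonlinearity σ)
    (d : ℕ → ℕ) (x : (n : ℕ) → Fin n → EuclideanSpace ℝ (Fin (d n)))
    (hx : ∀ n, 2 ≤ n → ∀ i, ‖x n i‖ = 1)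
    (δ : ℕ → ℝ) (hδ : ∀ n, 2 ≤ n → 0 < δ n)
    (hsep : ∀ n, 2 ≤ n → ∀ i j, i ≠ j → δ n ≤ SparseNTK.separability (x n) i j)
    (L : ℕ → ℕ)
    (hL : ∀ n, 2 ≤ n → SparseNTK.convDepth n (δ n) (SparseNTK.nonlinearity σ) ≤ L n)
    (s : ℕ → ℕ) (hs : (fun n => (s n : ℝ)) =O[atTop] fun n : ℕ => Real.log n)
    (M : (n : ℕ) → Matrix (Fin n) (Fin n) ℝ)
    (hM : ∀ n, 2 ≤ n →
      SparseNTK.IsSparsification (SparseNTK.ntkMatrix c σ (L n) (x n)) (M n) (s n)) :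
    (∀ (n : ℕ) (hn : 2 ≤ n),
      (∀ lam : ℝ, Module.End.HasEigenvalue (Matrix.toLin' (M n)) lam →
        SparseNTK.ntkMatrix c σ (L n) (x n) ⟨0, by omega⟩ ⟨0, by omega⟩ * (1 - 1 / (n : ℝ)) ≤ lam ∧
        lam ≤ SparseNTK.ntkMatrix c σ (L n) (x n) ⟨0, by omega⟩ ⟨0, by omega⟩ *
          (1 + 1 / (n : ℝ))) ∧
      1 ≤ SparseNTK.conditionNumber (M n) ∧
      SparseNTK.conditionNumber (M n) ≤ (1 + 1 / (n : ℝ)) / (1 - 1 / (n : ℝ))) ∧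
    Tendsto (fun n => SparseNTK.conditionNumber (M n)) atTop (𝓝 1) ∧
    (fun n => SparseNTK.conditionNumber (M n)) =O[atTop] fun n : ℕ => Real.log n := by
  have main : ∀ (n : ℕ) (hn : 2 ≤ n),
      (∀ lam : ℝ, Module.End.HasEigenvalue (Matrix.toLin' (M n)) lam →
        SparseNTK.ntkMatrix c σ (L n) (x n) ⟨0, by omega⟩ ⟨0, by omega⟩ * (1 - 1 / (n : ℝ)) ≤ lam ∧
        lam ≤ SparseNTK.ntkMatrix c σ (L n) (x n) ⟨0, by omega⟩ ⟨0, by omega⟩ *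
          (1 + 1 / (n : ℝ))) ∧
      1 ≤ SparseNTK.conditionNumber (M n) ∧
      SparseNTK.conditionNumber (M n) ≤ (1 + 1 / (n : ℝ)) / (1 - 1 / (n : ℝ)) := by
    intro n hn
    have hn2 : (2 : ℝ) ≤ n := by exact_mod_cast hn
    have hn0 : (0 : ℝ) < n := by linarith
    set K := SparseNTK.ntkFun c σ (L n) 1 with hK
    have hD : 0 < SparseNTK.dual (deriv σ) 1 := one_pos.trans_le hσ.one_le_dual_deriv
    have hμ1 : SparseNTK.nonlinearity σ ≤ 1 := sub_le_self _ (sq_nonneg _)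
    have hKpos : 0 < K := SparseNTK.ntkFun_one_pos hσ.dual_one hD c (L n)
    have hdiagK : ∀ i, SparseNTK.ntkMatrix c σ (L n) (x n) i i = K := fun i => by
      rw [SparseNTK.ntkMatrix, Matrix.of_apply, real_inner_self_eq_norm_sq, hx n hn i, one_pow]
    have hoffK : ∀ i j, i ≠ j →
        |SparseNTK.ntkMatrix c σ (L n) (x n) i j| ≤ K * (1 / (n : ℝ) ^ 2) := by
      intro i j hij
      have hij' := hsep n hn i j hij
      rw [SparseNTK.separability] at hij'
      refine (SparseNTK.abs_ntkFun_le hμ hμ1 hD hσ.dual_one (fun ρ hρ => hσ.abs_dual_le hρ)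
        (fun ρ hρ => hσ.abs_dual_deriv_le hρ) (by omega) (L n) (hδ n hn)
        (show |inner ℝ (x n i) (x n j)| ≤ 1 - δ n by linarith)).trans ?_
      exact mul_le_mul_of_nonneg_left (SparseNTK.inv_mul_pow_le_of_convDepth_le hμ hμ1 (hδ n hn)
        (by linarith [abs_nonneg (inner ℝ (x n i) (x n j))]) hn (hL n hn)) hKpos.le
    have hoffM : ∀ i j, i ≠ j → |M n i j| ≤ K * (1 / (n : ℝ) ^ 2) := by
      intro i j hij
      rcases (hM n hn).offDiag i j hij with h | h <;> rw [h]
      · exact hoffK i j hij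
      · rw [abs_zero]; positivity
    have heig : ∀ lam : ℝ, Module.End.HasEigenvalue (Matrix.toLin' (M n)) lam →
        K * (1 - 1 / (n : ℝ)) ≤ lam ∧ lam ≤ K * (1 + 1 / (n : ℝ)) := by
      intro lam hlam
      have h := SparseNTK.abs_eigenvalue_sub_le
        (fun i => ((hM n hn).diag i).trans (hdiagK i)) hoffM hlam
      -- The Gershgorin radius: fewer than `n` entries of size at most `K / n²`.
      have h2 : ((n : ℝ) - 1) * (K * (1 / (n : ℝ) ^ 2)) ≤ K * (1 / n) := by
        calc ((n : ℝ) - 1) * (K * (1 / (n : ℝ) ^ 2)) ≤ n * (K * (1 / (n : ℝ) ^ 2)) := by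
              gcongr; linarith
          _ = K * (1 / n) := by field_simp
      have := abs_le.1 (h.trans h2)
      constructor <;> linarith
    have hpos : (0 : ℝ) < 1 - 1 / n := by
      rw [sub_pos, div_lt_one hn0]; linarith
    refine ⟨fun lam hlam => by rw [hdiagK]; exact heig lam hlam, ?_⟩
    have h := SparseNTK.one_le_conditionNumber_and_le (by omega) (hM n hn).symm
      (mul_pos hKpos hpos) heig
    rwa [mul_div_mul_left _ _ hKpos.ne'] at h
  have hlim : Tendsto (fun n => SparseNTK.conditionNumber (M n)) atTop (𝓝 1) := by
    refine tendsto_of_tendsto_of_tendsto_of_le_of_le' tendsto_const_nhds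
      SparseNTK.tendsto_one_add_div_one_sub ?_ ?_
    · filter_upwards [eventually_ge_atTop 2] with n hn using (main n hn).2.1
    · filter_upwards [eventually_ge_atTop 2] with n hn using (main n hn).2.2
  refine ⟨main, hlim, (hlim.isBigO_one ℝ).trans ?_⟩
  refine IsBigO.of_bound 1 ?_
  filter_upwards [(Real.tendsto_log_atTop.comp tendsto_natCast_atTop_atTop).eventually_ge_atTop 1]
    with n hn
  simp only [Function.comp_apply] at hn
  rw [one_mul, norm_one, Real.norm_of_nonneg (by linarith)]
  exact hn
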